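/- Let $G$ be a connected simple undirected graph on the vertex set $\{1,\dots,n\}$, $n\ge 2$, with degrees $d_i$, neighbourhoods $N_i$ and $D=\mathrm{diag}(d_1,\dots,d_n)$, and let $x:[0,\infty)\to\mathbb R^n$ be the state of the $n$-agent system in which every agent applies the degree-normalized protocol $$\dot x_i(t)=\frac1{d_i}\sum_{j\in N_i}\bigl(x_j(t)-x_i(t)\bigr),\qquad x(0)\in\mathbb R^n .$$ Then the state $x(t)$ can be approximated by a randomized algorithm to within a multiplicative factor $(1\pm\epsilon)$ and an additive term $O(\epsilon)$, measured relative to the norm of the preference vector $x(0)^{\mathsf T}D$, in time $O\bigl(\frac{\log(\epsilon^{-1})\log n}{\epsilon^{3}\log\log(\epsilon^{-1})}\bigr)$ for every fixed $t$, with success probability at least $1-\epsilon$. Precisely, there are one fixed program and absolute constants $C,B$ such that for all $n\ge2$, all such $G$ and $x$, all $t\ge 0$ and all $0<\epsilon<1$, the program, started with $n$, $\epsilon$, $t$ and $\|x(0)^{\mathsf T}D\|_1=\sum_j d_j|x_j(0)|$ in its registers, always halts after at most $$B\,(1+t)\,\frac{L\,\log n}{\epsilon^{3}\,\log L},\qquad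 L=\max\{\log(\epsilon^{-1}),\,e\},$$ steps, and with probability at least $1-\epsilon$ its output $\hat x\in\mathbb R^n$ satisfies $$|\hat x_i-x_i(t)|\;\le\;\epsilon\,|x_i(t)|+C\,\epsilon\,\frac{\|x(0)^{\mathsf T}D\|_1}{d_i}\qquad\text{for every } i .$$ Programs run on a random access machine with registers for natural numbers, registers for reals and a memory of reals, all zero except for the input listed above; $\hat x$ is the content of the first $n$ memory cells at the end. Programs are built from instructions by sequencing, branching and while loops. Each instruction, each test (comparison of two registers of the same kind) and each sequencing step costs one unit of time. The instructions are: loading a constant (natural or rational); addition and truncated subtraction of natural numbers; $+,-,\times,/$ and $\log$ of reals; conversion of a natural number to a real; reading and writing a memory cell; and the queries or random draws: the degree of a given vertex, the initial value of a given agent, a uniformly random neighbour of a given vertex, a random vertex drawn with probabilities proportional to $d_v|x_v(0)|$, and a Poisson variable of given mean. -/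

import Mathlib

open scoped ENNReal

namespace WeightedConsensus

/-! ## The multi-agent system -/

/-- The protocol `u_i = (1 / d_i) ∑_{j ∈ N_i} (x_j - x_i)`. -/
noncomputable def protocol {n : ℕ} (G : SimpleGraph (Fin n)) [DecidableRel G.Adj]
    (x : Fin n → ℝ) (i : Fin n) : ℝ :=
  1 / (G.degree i : ℝ) * ∑ j ∈ G.neighborFinset i, (x j - x i)

/-- `x` is a trajectory on `[0, ∞)` of the system of integrator agents `ẋ_i = u_i` in which every
agent applies the protocol (one-sided derivative at time `0`). -/
def IsTrajectory {n : ℕ} (G : SimpleGraph (Fin n)) [DecidableRel G.Adj]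
    (x : ℝ → Fin n → ℝ) : Prop :=
  ∀ s : ℝ, 0 ≤ s → ∀ i : Fin n,
    HasDerivWithinAt (fun τ => x τ i) (protocol G (x s) i) (Set.Ici 0) s

/-- The norm `‖x₀ᵀ D‖₁ = ∑_j d_j |x₀_j|` of the preference vector `f = x₀ᵀ D`. -/
noncomputable def prefNorm {n : ℕ} (G : SimpleGraph (Fin n)) [DecidableRel G.Adj]
    (x₀ : Fin n → ℝ) : ℝ :=
  ∑ j, (G.degree j : ℝ) * |x₀ j|

/-! ## Randomized random access machine with unit-cost instructions

Programs are finite, fixed once and for all, and access the graph and the initial state only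
through the unit-cost queries `degree`, `initState`, `sampleStart` and `sampleNeighbor`. -/

/-- Unit-cost instructions in three-address form; the arguments are register numbers, except for
the constants of `natConst` and `realConst`. -/
inductive Op where
  /-- `N[a] ← k` -/
  | natConst (a : ℕ) (k : ℕ)
  /-- `N[a] ← N[b] + N[c]` -/
  | natAdd (a b c : ℕ)
  /-- `N[a] ← max (N[b] - N[c]) 0` -/
  | natSub (a b c : ℕ)
  /-- `R[a] ← q` -/
  | realConst (a : ℕ) (q : ℚ)
  /-- `R[a] ← R[b] + R[c]` -/
  | realAdd (a b c : ℕ)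
  /-- `R[a] ← R[b] - R[c]` -/
  | realSub (a b c : ℕ)
  /-- `R[a] ← R[b] * R[c]` -/
  | realMul (a b c : ℕ)
  /-- `R[a] ← R[b] / R[c]` -/
  | realDiv (a b c : ℕ)
  /-- `R[a] ← log R[b]` -/
  | realLog (a b : ℕ)
  /-- `R[a] ← N[b]` -/
  | natToReal (a b : ℕ)
  /-- `R[a] ← mem[N[b]]` -/
  | load (a b : ℕ)
  /-- `mem[N[a]] ← R[b]` -/
  | store (a b : ℕ)
  /-- `N[a] ←` the degree of vertex `N[b]` -/
  | degree (a b : ℕ)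
  /-- `R[a] ←` the initial value of agent `N[b]` -/
  | initState (a b : ℕ)
  /-- `N[a] ←` a random vertex, with probabilities proportional to `d_v |x_v(0)|` -/
  | sampleStart (a : ℕ)
  /-- `N[a] ←` a uniformly random neighbour of vertex `N[b]` -/
  | sampleNeighbor (a b : ℕ)
  /-- `N[a] ←` a Poisson variable with mean `R[b]` -/
  | samplePoisson (a b : ℕ)

/-- Comparisons of two registers. -/
inductive Test where
  /-- `N[a] < N[b]` -/
  | natLt (a b : ℕ)
  /-- `R[a] < R[b]` -/
  | realLt (a b : ℕ)

/-- Structured programs. -/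
inductive Prog where
  | op (o : Op)
  | seq (p q : Prog)
  | branch (b : Test) (p q : Prog)
  | loop (b : Test) (p : Prog)

/-- Registers for natural numbers, registers for reals, and a memory of reals. -/
structure Store where
  nat : ℕ → ℕ
  real : ℕ → ℝ
  mem : ℕ → ℝ

/-- `N[a] ← k` -/
def Store.setNat (σ : Store) (a k : ℕ) : Store :=
  { σ with nat := Function.update σ.nat a k }

/-- `R[a] ← r` -/
noncomputable def Store.setReal (σ : Store) (a : ℕ) (r : ℝ) : Store :=
  { σ with real := Function.update σ.real a r }

/-- `mem[k] ← r` -/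
noncomputable def Store.setMem (σ : Store) (k : ℕ) (r : ℝ) : Store :=
  { σ with mem := Function.update σ.mem k r }

/-- The value of a test. -/
def Test.Holds (σ : Store) : Test → Prop
  | .natLt a b => σ.nat a < σ.nat b
  | .realLt a b => σ.real a < σ.real b

/-- Answer to a degree query (`0` if `v` is not a vertex). -/
def degreeQuery {n : ℕ} (G : SimpleGraph (Fin n)) [DecidableRel G.Adj] (v : ℕ) : ℕ :=
  if h : v < n then G.degree ⟨v, h⟩ else 0

/-- Answer to a query for an initial value (`0` if `v` is not a vertex). -/
noncomputable def stateQuery {n : ℕ} (x₀ : Fin n → ℝ) (v : ℕ) : ℝ :=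
  if h : v < n then x₀ ⟨v, h⟩ else 0

/-- The weight `d_v |x₀_v|` of vertex `v`. -/
noncomputable def startWeight {n : ℕ} (G : SimpleGraph (Fin n)) [DecidableRel G.Adj]
    (x₀ : Fin n → ℝ) (v : Fin n) : ℝ≥0∞ :=
  ENNReal.ofReal ((G.degree v : ℝ) * |x₀ v|)

theorem tsum_startWeight_ne_top {n : ℕ} (G : SimpleGraph (Fin n)) [DecidableRel G.Adj]
    (x₀ : Fin n → ℝ) : ∑' v, startWeight G x₀ v ≠ ∞ := by
  rw [tsum_fintype]
  exact ENNReal.sum_ne_top.2 fun v _ => ENNReal.ofReal_ne_top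

open Classical in
/-- Random vertex with probabilities proportional to `d_v |x₀_v|` (vertex `0` if all weights
vanish). -/
noncomputable def startPMF {n : ℕ} (G : SimpleGraph (Fin n)) [DecidableRel G.Adj]
    (x₀ : Fin n → ℝ) : PMF ℕ :=
  if h : ∑' v, startWeight G x₀ v ≠ 0 then
    (PMF.normalize (startWeight G x₀) h (tsum_startWeight_ne_top G x₀)).map Fin.val
  else PMF.pure 0

open Classical in
/-- One step of the random walk with transition matrix `P = D⁻¹ A` (no move if `v` is not a vertex
or has no neighbour). -/
noncomputable def neighborPMF {n : ℕ} (G : SimpleGraph (Fin n)) [DecidableRel G.Adj]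
    (v : ℕ) : PMF ℕ :=
  if h : v < n then
    if h' : (G.neighborFinset ⟨v, h⟩).Nonempty then
      (PMF.uniformOfFinset (G.neighborFinset ⟨v, h⟩) h').map Fin.val
    else PMF.pure v
  else PMF.pure v

/-- Effect of one instruction. -/
noncomputable def Op.exec {n : ℕ} (G : SimpleGraph (Fin n)) [DecidableRel G.Adj]
    (x₀ : Fin n → ℝ) (σ : Store) : Op → PMF Store
  | .natConst a k => PMF.pure (σ.setNat a k)
  | .natAdd a b c => PMF.pure (σ.setNat a (σ.nat b + σ.nat c))
  | .natSub a b c => PMF.pure (σ.setNat a (σ.nat b - σ.nat c))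
  | .realConst a q => PMF.pure (σ.setReal a (q : ℝ))
  | .realAdd a b c => PMF.pure (σ.setReal a (σ.real b + σ.real c))
  | .realSub a b c => PMF.pure (σ.setReal a (σ.real b - σ.real c))
  | .realMul a b c => PMF.pure (σ.setReal a (σ.real b * σ.real c))
  | .realDiv a b c => PMF.pure (σ.setReal a (σ.real b / σ.real c))
  | .realLog a b => PMF.pure (σ.setReal a (Real.log (σ.real b)))
  | .natToReal a b => PMF.pure (σ.setReal a (σ.nat b : ℝ))
  | .load a b => PMF.pure (σ.setReal a (σ.mem (σ.nat b)))
  | .store a b => PMF.pure (σ.setMem (σ.nat a) (σ.real b))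
  | .degree a b => PMF.pure (σ.setNat a (degreeQuery G (σ.nat b)))
  | .initState a b => PMF.pure (σ.setReal a (stateQuery x₀ (σ.nat b)))
  | .sampleStart a => (startPMF G x₀).map (σ.setNat a)
  | .sampleNeighbor a b => (neighborPMF G (σ.nat b)).map (σ.setNat a)
  | .samplePoisson a b =>
      (ProbabilityTheory.poissonMeasure (σ.real b).toNNReal).toPMF.map (σ.setNat a)

/-- A configuration: the programs that remain to be executed, in order, and the store. -/
structure Config where
  todo : List Prog
  store : Store

/-- A configuration is halted when nothing remains to be executed. -/
def Config.Halted (c : Config) : Prop := c.todo = []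

open Classical in
/-- One step of the machine: it costs one unit of time, and a halted machine does not move. -/
noncomputable def step {n : ℕ} (G : SimpleGraph (Fin n)) [DecidableRel G.Adj]
    (x₀ : Fin n → ℝ) : Config → PMF Config
  | ⟨[], σ⟩ => PMF.pure ⟨[], σ⟩
  | ⟨.op o :: k, σ⟩ => (o.exec G x₀ σ).map (Config.mk k)
  | ⟨.seq p q :: k, σ⟩ => PMF.pure ⟨p :: q :: k, σ⟩
  | ⟨.branch b p q :: k, σ⟩ => PMF.pure ⟨(if b.Holds σ then p else q) :: k, σ⟩
  | ⟨.loop b p :: k, σ⟩ => PMF.pure ⟨if b.Holds σ then p :: .loop b p :: k else k, σ⟩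

/-- Distribution of the configuration after `T` steps. -/
noncomputable def run {n : ℕ} (G : SimpleGraph (Fin n)) [DecidableRel G.Adj]
    (x₀ : Fin n → ℝ) : ℕ → Config → PMF Config
  | 0, c => PMF.pure c
  | T + 1, c => (step G x₀ c).bind (run G x₀ T)

/-- Initial configuration: `N[0] = n`, `R[0] = ε`, `R[1] = t`, `R[2] = ‖x₀ᵀ D‖₁`, and all other
registers and memory cells are `0`. -/
noncomputable def initConfig {n : ℕ} (G : SimpleGraph (Fin n)) [DecidableRel G.Adj]
    (x₀ : Fin n → ℝ) (t ε : ℝ) (p : Prog) : Config where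
  todo := [p]
  store :=
    { nat := fun a => if a = 0 then n else 0
      real := fun a => if a = 0 then ε else if a = 1 then t else
        if a = 2 then prefNorm G x₀ else 0
      mem := fun _ => 0 }

/-- The output vector in `ℝⁿ`: the first `n` memory cells. -/
def Config.output (c : Config) {n : ℕ} (i : Fin n) : ℝ := c.store.mem i

/-! ## The guarantee and the time bound -/

/-- `y` approximates the state `z` up to the factor `1 ± ε` and, in entry `i`, the additive term
`C ε ‖x₀ᵀ D‖₁ / d_i`. -/
def Approximates {n : ℕ} (G : SimpleGraph (Fin n)) [DecidableRel G.Adj]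
    (x₀ : Fin n → ℝ) (ε C : ℝ) (z y : Fin n → ℝ) : Prop :=
  ∀ i, |y i - z i| ≤ ε * |z i| + C * ε * (prefNorm G x₀ / (G.degree i : ℝ))

/-- `L(ε) = max (log (1/ε)) e`, so that `L / log L` is `log(1/ε) / log log(1/ε)` for small `ε`
and is a positive constant when `log log(1/ε)` is small, negative or undefined. -/
noncomputable def logInv (ε : ℝ) : ℝ := max (Real.log (1 / ε)) (Real.exp 1)

/-- `log(1/ε) log n / (ε³ log log(1/ε))`. -/
noncomputable def hkprComplexity (n : ℕ) (ε : ℝ) : ℝ :=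
  logInv ε * Real.log n / (ε ^ 3 * Real.log (logInv ε))

end WeightedConsensus

namespace WeightedConsensus


/-! The protocol is `ẋ = (P - 1) x`, where `P` is the transition operator of the simple random walk,
so `x(t)` is the average of `P^k x(0)` over a Poisson variable `k` of mean `t`. Since `P` is
self-adjoint for the degree weights, `d_i x_i(t)` is `F = ‖x(0)ᵀD‖₁` times the expected sign of
`x_v(0)` on the event that a walk of `k` steps ends at `i`, with `v` drawn proportionally to `d_v
|x_v(0)|`. One walk therefore serves all coordinates at once.

The program averages `⌈1/ε³⌉` such walks. Lengths above `K = (1+t) ℓ / log ℓ`, `ℓ = max (log (1/ε))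
3`, are replaced by `0`; by a Chernoff bound this biases the estimate by at most `2εF/d_i`
(`IsTrajectory.abs_mean_sub_le`, `chernoff_le`). A sample changes a single coordinate, so the
squared error summed over all coordinates does not grow with `n`, and Chebyshev's inequality
controls every coordinate together.

On the machine, Chebyshev becomes a supermartingale argument: `Fails` bounds the failure probability
from a configuration, a random instruction averages these bounds, and `potential` does not increase
in expectation along an iteration (`tsum_mul_potential_le`, `fails_sampleLoop`). The additive error
alone suffices; the allowance `ε|x_i(t)|` only adds slack. -/

/-- From `c`, the machine has halted with certainty after any number of steps `≥ N`, and the final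
store violates `E` with probability at most `b`. -/
def Fails {n : ℕ} (G : SimpleGraph (Fin n)) [DecidableRel G.Adj] (x₀ : Fin n → ℝ)
    (E : Store → Prop) (c : Config) (N : ℕ) (b : ℝ≥0∞) : Prop :=
  ∀ M, N ≤ M → (∀ c' ∈ (run G x₀ M c).support, c'.Halted) ∧
    (run G x₀ M c).toOuterMeasure {c' | ¬ E c'.store} ≤ b

/-! ### Rules bounding running time and failure probability of programs. -/

section Calculus

variable {n : ℕ} {G : SimpleGraph (Fin n)} [DecidableRel G.Adj] {x₀ : Fin n → ℝ}
  {E : Store → Prop} {N N' : ℕ} {b b' : ℝ≥0∞} {σ : Store} {k : List Prog}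

theorem Fails.mono {c : Config} (h : Fails G x₀ E c N b) (hN : N ≤ N') (hb : b ≤ b') :
    Fails G x₀ E c N' b' :=
  fun M hM => ⟨(h M (hN.trans hM)).1, (h M (hN.trans hM)).2.trans hb⟩

theorem run_nil (M : ℕ) : run G x₀ M ⟨[], σ⟩ = PMF.pure ⟨[], σ⟩ := by
  induction M with
  | zero => rfl
  | succ M ih => rw [run, step, PMF.pure_bind, ih]

theorem Fails.nil (h : ¬ E σ → 1 ≤ b) : Fails G x₀ E ⟨[], σ⟩ 0 b := by
  intro M _
  rw [run_nil]
  refine ⟨fun c' hc' => ?_, ?_⟩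
  · rw [PMF.support_pure, Set.mem_singleton_iff] at hc'
    rw [hc', Config.Halted]
  · classical
    rw [PMF.toOuterMeasure_pure_apply]
    split_ifs with hE
    · exact h hE
    · exact zero_le

/-- Law of total probability over the first step. Letting `β` depend on the outcome allows a failure
bound to be an expectation of later bounds. -/
theorem Fails.of_step_map {α : Type*} {c : Config} {ξ : PMF α} {g : α → Config} {β : α → ℝ≥0∞}
    (hs : step G x₀ c = ξ.map g) (h : ∀ a ∈ ξ.support, Fails G x₀ E (g a) N (β a)) :
    Fails G x₀ E c (N + 1) (∑' a, ξ a * β a) := by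
  intro M hM
  obtain ⟨M, rfl⟩ : ∃ m, M = m + 1 := ⟨M - 1, by omega⟩
  have hM' : N ≤ M := by omega
  rw [run, hs, PMF.bind_map]
  refine ⟨fun c' hc' => ?_, ?_⟩
  · obtain ⟨a, ha, hc'⟩ := (PMF.mem_support_bind_iff _ _ _).1 hc'
    exact (h a ha M hM').1 c' hc'
  · rw [PMF.toOuterMeasure_bind_apply]
    refine ENNReal.tsum_le_tsum fun a => ?_
    by_cases ha : a ∈ ξ.support
    · exact mul_le_mul_right ((h a ha M hM').2) _
    · rw [PMF.mem_support_iff, not_not] at ha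
      simp [ha]

theorem Fails.of_step_pure {c c' : Config} (hs : step G x₀ c = PMF.pure c')
    (h : Fails G x₀ E c' N b) : Fails G x₀ E c (N + 1) b := by
  have := Fails.of_step_map (ξ := PMF.pure ()) (g := fun _ => c') (β := fun _ => b) (N := N)
    (E := E) (c := c) (by rw [hs, PMF.pure_map]) (fun _ _ => h)
  simpa using this

theorem Fails.op {o : Op} {σ' : Store} (hs : o.exec G x₀ σ = PMF.pure σ')
    (h : Fails G x₀ E ⟨k, σ'⟩ N b) : Fails G x₀ E ⟨.op o :: k, σ⟩ (N + 1) b :=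
  Fails.of_step_pure (by rw [step, hs, PMF.pure_map]) h

theorem Fails.random {α : Type*} {o : Op} {ξ : PMF α} {f : α → Store} {β : α → ℝ≥0∞}
    (hs : o.exec G x₀ σ = ξ.map f) (h : ∀ a, Fails G x₀ E ⟨k, f a⟩ N (β a)) :
    Fails G x₀ E ⟨.op o :: k, σ⟩ (N + 1) (∑' a, ξ a * β a) :=
  Fails.of_step_map (by rw [step, hs, PMF.map_comp]; rfl) fun a _ => h a

theorem Fails.seq {p q : Prog} (h : Fails G x₀ E ⟨p :: q :: k, σ⟩ N b) :
    Fails G x₀ E ⟨.seq p q :: k, σ⟩ (N + 1) b :=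
  Fails.of_step_pure (by rw [step]) h

theorem Fails.branch_true {t : Test} {p q : Prog} (ht : t.Holds σ)
    (h : Fails G x₀ E ⟨p :: k, σ⟩ N b) : Fails G x₀ E ⟨.branch t p q :: k, σ⟩ (N + 1) b :=
  Fails.of_step_pure (by rw [step, if_pos ht]) h

theorem Fails.branch_false {t : Test} {p q : Prog} (ht : ¬ t.Holds σ)
    (h : Fails G x₀ E ⟨q :: k, σ⟩ N b) : Fails G x₀ E ⟨.branch t p q :: k, σ⟩ (N + 1) b :=
  Fails.of_step_pure (by rw [step, if_neg ht]) h

theorem Fails.loop_true {t : Test} {p : Prog} (ht : t.Holds σ)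
    (h : Fails G x₀ E ⟨p :: .loop t p :: k, σ⟩ N b) :
    Fails G x₀ E ⟨.loop t p :: k, σ⟩ (N + 1) b :=
  Fails.of_step_pure (by rw [step, if_pos ht]) h

theorem Fails.loop_false {t : Test} {p : Prog} (ht : ¬ t.Holds σ)
    (h : Fails G x₀ E ⟨k, σ⟩ N b) : Fails G x₀ E ⟨.loop t p :: k, σ⟩ (N + 1) b :=
  Fails.of_step_pure (by rw [step, if_neg ht]) h

theorem Fails.success {c : Config} {ε : ℝ} (hε : 0 ≤ ε) (h : Fails G x₀ E c N (ENNReal.ofReal ε)) :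
    ENNReal.ofReal (1 - ε) ≤ (run G x₀ N c).toOuterMeasure {c' | E c'.store} := by
  rw [ENNReal.ofReal_sub _ hε, ENNReal.ofReal_one, tsub_le_iff_right]
  have h1 : (run G x₀ N c).toOuterMeasure Set.univ = 1 := by
    rw [PMF.toOuterMeasure_apply_eq_one_iff]; exact Set.subset_univ _
  rw [← h1]
  have h2 : (Set.univ : Set Config) = {c' | E c'.store} ∪ {c' | ¬ E c'.store} :=
    (Set.union_compl_self _).symm
  rw [h2]
  exact (MeasureTheory.measure_union_le _ _).trans (add_le_add_right (h N le_rfl).2 _)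

end Calculus


/-! ### The random walk and its reversibility. -/

section RandomWalk

variable {n : ℕ} (G : SimpleGraph (Fin n)) [DecidableRel G.Adj]

open Classical in
/-- One step of the random walk, as a distribution on the vertices. -/
noncomputable def neighborStep (v : Fin n) : PMF (Fin n) :=
  if h : (G.neighborFinset v).Nonempty then PMF.uniformOfFinset (G.neighborFinset v) h
  else PMF.pure v

theorem neighborPMF_eq_map (v : Fin n) :
    neighborPMF G v = (neighborStep G v).map Fin.val := by
  unfold neighborPMF neighborStep
  rw [dif_pos v.isLt]
  split_ifs with h
  · rfl
  · rw [PMF.pure_map]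

/-- The `k`-step random walk started at a vertex. -/
noncomputable def walk : ℕ → Fin n → PMF (Fin n)
  | 0, v => PMF.pure v
  | k + 1, v => (neighborStep G v).bind (walk k)

/-- The transition operator `P` of the random walk. -/
noncomputable def transition : (Fin n → ℝ) →ₗ[ℝ] (Fin n → ℝ) where
  toFun y v := ∑ j, (neighborStep G v j).toReal * y j
  map_add' y z := by
    ext v
    simp [mul_add, Finset.sum_add_distrib]
  map_smul' c y := by
    ext v
    simp only [Pi.smul_apply, smul_eq_mul, Finset.mul_sum, RingHom.id_apply]
    exact Finset.sum_congr rfl fun j _ => by ring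

theorem transition_apply (y : Fin n → ℝ) (v : Fin n) :
    transition G y v = ∑ j, (neighborStep G v j).toReal * y j := rfl

theorem sum_bind_toReal_mul {α : Type*} [Fintype α] (p : PMF α) (q : α → PMF α) (y : α → ℝ) :
    ∑ j, ((p.bind q) j).toReal * y j = ∑ a, (p a).toReal * ∑ j, (q a j).toReal * y j := by
  simp_rw [PMF.bind_apply, tsum_fintype, Finset.mul_sum]
  rw [Finset.sum_comm]
  refine Finset.sum_congr rfl fun j _ => ?_
  rw [ENNReal.toReal_sum fun a _ => ENNReal.mul_ne_top (p.apply_ne_top a) ((q a).apply_ne_top j),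
    Finset.sum_mul]
  exact Finset.sum_congr rfl fun a _ => by rw [ENNReal.toReal_mul, mul_assoc]

theorem sum_walk_mul (k : ℕ) (v : Fin n) (y : Fin n → ℝ) :
    ∑ j, (walk G k v j).toReal * y j = (transition G ^ k) y v := by
  induction k generalizing v with
  | zero =>
    rw [Finset.sum_eq_single v]
    · simp [walk]
    · intro j _ hj
      simp [walk, hj]
    · simp
  | succ k ih =>
    rw [walk, sum_bind_toReal_mul, pow_succ', Module.End.mul_apply, transition_apply]
    exact Finset.sum_congr rfl fun a _ => by rw [ih]

variable {G}

theorem transition_eq {v : Fin n} (hv : 0 < G.degree v) (y : Fin n → ℝ) :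
    transition G y v = 1 / (G.degree v : ℝ) * ∑ j ∈ G.neighborFinset v, y j := by
  classical
  have hne : (G.neighborFinset v).Nonempty := by
    rwa [← Finset.card_pos, G.card_neighborFinset_eq_degree]
  rw [transition_apply, neighborStep, dif_pos hne, Finset.mul_sum,
    ← Finset.sum_subset (Finset.subset_univ (G.neighborFinset v))]
  · refine Finset.sum_congr rfl fun j hj => ?_
    rw [PMF.uniformOfFinset_apply_of_mem hne hj, G.card_neighborFinset_eq_degree]
    simp
  · intro j _ hj
    rw [PMF.uniformOfFinset_apply_of_notMem hne hj]
    simp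

/-- The matrix of `d_v P_{vj}` is the adjacency matrix, which is symmetric. -/
theorem sum_degree_mul_transition (hG : ∀ v, 0 < G.degree v) (y z : Fin n → ℝ) :
    ∑ v, (G.degree v : ℝ) * y v * transition G z v =
      ∑ v, (G.degree v : ℝ) * transition G y v * z v := by
  have hd : ∀ v, (G.degree v : ℝ) ≠ 0 := fun v => by exact_mod_cast (hG v).ne'
  have key : ∀ a b : Fin n → ℝ, ∀ v, (G.degree v : ℝ) * a v * transition G b v =
      ∑ j, if G.Adj v j then a v * b j else 0 := by
    intro a b v
    rw [transition_eq (hG v), ← Finset.sum_filter, ← Finset.mul_sum,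
      ← SimpleGraph.neighborFinset_eq_filter]
    field_simp [hd v]
  have e1 : ∀ v, (G.degree v : ℝ) * transition G y v * z v =
      (G.degree v : ℝ) * z v * transition G y v := fun v => by ring
  simp_rw [e1, key]
  rw [Finset.sum_comm]
  refine Finset.sum_congr rfl fun v _ => Finset.sum_congr rfl fun j _ => ?_
  simp only [G.adj_comm j v, mul_comm]

theorem sum_degree_mul_transition_pow (hG : ∀ v, 0 < G.degree v) (k : ℕ) (y z : Fin n → ℝ) :
    ∑ v, (G.degree v : ℝ) * y v * (transition G ^ k) z v =
      ∑ v, (G.degree v : ℝ) * (transition G ^ k) y v * z v := by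
  induction k generalizing y with
  | zero => simp
  | succ k ih =>
    rw [pow_succ', Module.End.mul_apply, sum_degree_mul_transition hG, ih, ← Module.End.mul_apply,
      ← pow_succ, ← pow_succ']

/-- Reversibility turns walks that start at weighted vertices and end at `i` into the value of `P^k
y` at `i`; this is what makes forward sampling estimate the state. -/
theorem sum_degree_mul_walk (hG : ∀ v, 0 < G.degree v) (k : ℕ) (y : Fin n → ℝ) (i : Fin n) :
    ∑ v, (G.degree v : ℝ) * y v * (walk G k v i).toReal =
      (G.degree i : ℝ) * (transition G ^ k) y i := by
  have h : ∀ v, (walk G k v i).toReal = (transition G ^ k) (Pi.single i 1) v := fun v => by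
    rw [← sum_walk_mul]
    simp [Pi.single_apply]
  simp_rw [h]
  rw [sum_degree_mul_transition_pow hG]
  simp [Pi.single_apply]

end RandomWalk

/-! ### The trajectory as a Poisson average of powers of `P`. -/

section Flow

/-- The curve `s ↦ exp((t-s)A) z(s)` has derivative zero on `[0, t]`, so its endpoint values agree.
-/
theorem eq_exp_smul_of_hasDerivWithinAt {V : Type*} [NormedAddCommGroup V] [NormedSpace ℝ V]
    [CompleteSpace V] (A : V →L[ℝ] V) {z : ℝ → V}
    (hz : ∀ s, 0 ≤ s → HasDerivWithinAt z (A (z s)) (Set.Ici 0) s) {t : ℝ} (ht : 0 ≤ t) :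
    z t = NormedSpace.exp (t • A) (z 0) := by
  have hd : ∀ s, 0 ≤ s →
      HasDerivWithinAt (fun s => NormedSpace.exp ((t - s) • A) (z s)) 0 (Set.Ici 0) s := by
    intro s hs
    have h1 : HasDerivAt (fun s : ℝ => NormedSpace.exp ((t - s) • A))
        (-(NormedSpace.exp ((t - s) • A) * A)) s := by
      have := (hasDerivAt_exp_smul_const (𝕂 := ℝ) A (t - s)).scomp s
        ((hasDerivAt_id s).const_sub t)
      exact this.congr_deriv (neg_one_smul _ _)
    have h2 := h1.hasDerivWithinAt.clm_apply (hz s hs)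
    convert h2 using 1
    simp
  have := constant_of_has_deriv_right_zero (a := 0) (b := t)
    (fun s hs => ((hd s hs.1).continuousWithinAt).mono Set.Icc_subset_Ici_self)
    (fun s hs => (hd s hs.1).mono (Set.Ici_subset_Ici.2 hs.1)) t ⟨ht, le_rfl⟩
  simpa using this

theorem hasSum_exp_smul_apply {n : ℕ} (A : (Fin n → ℝ) →ₗ[ℝ] (Fin n → ℝ)) (t : ℝ)
    (y : Fin n → ℝ) (i : Fin n) :
    HasSum (fun k : ℕ => t ^ k / k.factorial * (A ^ k) y i)
      (NormedSpace.exp (t • LinearMap.toContinuousLinearMap A) y i) := by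
  have h := NormedSpace.exp_series_hasSum_exp' (𝕂 := ℝ) (t • LinearMap.toContinuousLinearMap A)
  have h2 := ((ContinuousLinearMap.apply ℝ (Fin n → ℝ) y).hasSum h)
  have h3 := (ContinuousLinearMap.proj (R := ℝ) (φ := fun _ : Fin n => ℝ) i).hasSum h2
  have hpow : ∀ k : ℕ, (LinearMap.toContinuousLinearMap A ^ k) y = (A ^ k) y := by
    intro k
    induction k with
    | zero => simp
    | succ k ih =>
      rw [pow_succ', pow_succ', mul_apply_eq_comp, ih, Module.End.mul_apply]
      rfl
  refine Eq.mp (congrArg (HasSum · _) (funext fun k => ?_)) h3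
  simp only [smul_pow, map_smul, ContinuousLinearMap.apply_apply, hpow,
    ContinuousLinearMap.proj_apply, smul_eq_mul]
  ring

variable {n : ℕ} {G : SimpleGraph (Fin n)} [DecidableRel G.Adj] {x : ℝ → Fin n → ℝ}

/-- The rescaled curve `e^s x(s)` solves `ż = P z`, so only the exponential series of `P` is needed;
the factor `e^{-t}` then produces the Poisson weights. -/
theorem IsTrajectory.hasSum (hx : IsTrajectory G x) (hG : ∀ v, 0 < G.degree v) {t : ℝ}
    (ht : 0 ≤ t) (i : Fin n) :
    HasSum (fun k : ℕ => Real.exp (-t) * t ^ k / k.factorial * (transition G ^ k) (x 0) i)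
      (x t i) := by
  have hz : ∀ s, 0 ≤ s → HasDerivWithinAt (fun s => Real.exp s • x s)
      (LinearMap.toContinuousLinearMap (transition G) (Real.exp s • x s)) (Set.Ici 0) s := by
    intro s hs
    have h1 : HasDerivWithinAt x (protocol G (x s)) (Set.Ici 0) s :=
      hasDerivWithinAt_pi.2 (hx s hs)
    have h2 := (Real.hasDerivAt_exp s).hasDerivWithinAt.smul h1 (s := Set.Ici 0)
    refine HasDerivWithinAt.congr_deriv h2 (funext fun v => ?_)
    have hd : (G.degree v : ℝ) ≠ 0 := by exact_mod_cast (hG v).ne'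
    rw [map_smul]
    simp only [LinearMap.coe_toContinuousLinearMap', Pi.add_apply, Pi.smul_apply, smul_eq_mul,
      transition_eq (hG v), protocol, Finset.sum_sub_distrib, Finset.sum_const,
      G.card_neighborFinset_eq_degree, nsmul_eq_mul]
    field_simp
    ring
  have h := eq_exp_smul_of_hasDerivWithinAt _ hz ht
  have hs := (hasSum_exp_smul_apply (transition G) t (x 0) i).mul_left (Real.exp (-t))
  have hxt : x t i = Real.exp (-t) *
      NormedSpace.exp (t • LinearMap.toContinuousLinearMap (transition G)) (x 0) i := by
    have := congrFun h i
    simp only [Real.exp_zero, one_smul, Pi.smul_apply, smul_eq_mul] at this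
    rw [← this, ← mul_assoc, ← Real.exp_add]
    simp
  rw [hxt]
  refine Eq.mp (congrArg (HasSum · _) (funext fun k => ?_)) hs
  ring

end Flow


/-! ### Start distribution, truncated walk lengths and bias. -/

section Sampling

theorem tsum_bind_mul {α β : Type*} (p : PMF α) (q : α → PMF β) (f : β → ℝ≥0∞) :
    ∑' b, (p.bind q) b * f b = ∑' a, p a * ∑' b, q a b * f b := by
  simp_rw [PMF.bind_apply, ← ENNReal.tsum_mul_right, ← ENNReal.tsum_mul_left, mul_assoc]
  exact ENNReal.tsum_comm

variable {n : ℕ} (G : SimpleGraph (Fin n)) [DecidableRel G.Adj] (x₀ : Fin n → ℝ)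

theorem prefNorm_nonneg : 0 ≤ prefNorm G x₀ :=
  Finset.sum_nonneg fun _ _ => by positivity

/-- The weights are stated as a product rather than a quotient so that the case `x₀ᵀD = 0`, where
the draw is arbitrary, is covered too. -/
theorem exists_startPMF_eq_map (hn : 0 < n) :
    ∃ ξ : PMF (Fin n), startPMF G x₀ = ξ.map Fin.val ∧
      ∀ v, prefNorm G x₀ * (ξ v).toReal = (G.degree v : ℝ) * |x₀ v| := by
  have hw : ∀ v, 0 ≤ (G.degree v : ℝ) * |x₀ v| := fun v => by positivity
  have hsum : ∑' v, startWeight G x₀ v = ENNReal.ofReal (prefNorm G x₀) := by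
    rw [tsum_fintype, prefNorm, ENNReal.ofReal_sum_of_nonneg fun v _ => hw v]
    rfl
  by_cases h : ∑' v, startWeight G x₀ v ≠ 0
  · refine ⟨PMF.normalize (startWeight G x₀) h (tsum_startWeight_ne_top G x₀),
      by rw [startPMF, dif_pos h], fun v => ?_⟩
    have hF : prefNorm G x₀ ≠ 0 := fun h0 => h (by rw [hsum, h0, ENNReal.ofReal_zero])
    rw [PMF.normalize_apply, hsum, ENNReal.toReal_mul, ENNReal.toReal_inv,
      ENNReal.toReal_ofReal (prefNorm_nonneg G x₀), startWeight, ENNReal.toReal_ofReal (hw v)]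
    field_simp
  · refine ⟨PMF.pure ⟨0, hn⟩, by rw [startPMF, dif_neg h, PMF.pure_map], fun v => ?_⟩
    rw [not_not] at h
    have hF : prefNorm G x₀ = 0 :=
      le_antisymm (ENNReal.ofReal_eq_zero.1 (hsum ▸ h)) (prefNorm_nonneg G x₀)
    have := (Finset.sum_eq_zero_iff_of_nonneg fun v _ => hw v).1 hF v (Finset.mem_univ v)
    rw [hF, this, zero_mul]

/-- A walk length, replaced by `0` if it exceeds the cap `K`. -/
noncomputable def truncate (K : ℝ) (k : ℕ) : ℕ := if K < k then 0 else k

theorem truncate_le (K : ℝ) (k : ℕ) : truncate K k ≤ ⌊K⌋₊ := by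
  unfold truncate
  split_ifs with h
  · exact Nat.zero_le _
  · exact Nat.le_floor (not_lt.1 h)

/-- Endpoint of the random walk from `v` with a truncated Poisson number of steps. -/
noncomputable def endLaw (t K : ℝ) (v : Fin n) : PMF (Fin n) :=
  (ProbabilityTheory.poissonMeasure t.toNNReal).toPMF.bind fun k => walk G (truncate K k) v

variable {G} {x : ℝ → Fin n → ℝ}

theorem poisson_apply {t : ℝ} (ht : 0 ≤ t) (k : ℕ) :
    ((ProbabilityTheory.poissonMeasure t.toNNReal).toPMF k).toReal =
      Real.exp (-t) * t ^ k / k.factorial := by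
  rw [MeasureTheory.Measure.toPMF_apply, ProbabilityTheory.poissonMeasure_singleton,
    ENNReal.toReal_ofReal (by positivity), Real.coe_toNNReal t ht]

theorem hasSum_endLaw {t : ℝ} (ht : 0 ≤ t) (K : ℝ) (v i : Fin n) :
    HasSum (fun k : ℕ => Real.exp (-t) * t ^ k / k.factorial * (walk G (truncate K k) v i).toReal)
      (endLaw G t K v i).toReal := by
  have h0 : ∀ k, (ProbabilityTheory.poissonMeasure t.toNNReal).toPMF k *
      walk G (truncate K k) v i ≠ ∞ := fun k =>
    ENNReal.mul_ne_top (PMF.apply_ne_top _ _) (PMF.apply_ne_top _ _)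
  have h1 : ∑' k, (ProbabilityTheory.poissonMeasure t.toNNReal).toPMF k *
      walk G (truncate K k) v i ≠ ∞ := by
    have := (endLaw G t K v).apply_ne_top i
    rwa [endLaw, PMF.bind_apply] at this
  have h2 := ENNReal.hasSum_toReal h1
  rw [← ENNReal.tsum_toReal_eq h0] at h2
  rw [endLaw, PMF.bind_apply]
  simpa only [ENNReal.toReal_mul, poisson_apply ht] using h2

/-- The Poisson generating function, needed with `a ≥ 1` for the Chernoff bound. -/
theorem hasSum_poisson_mul_pow (t a : ℝ) :
    HasSum (fun k : ℕ => Real.exp (-t) * t ^ k / k.factorial * a ^ k)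
      (Real.exp (t * (a - 1))) := by
  have h := (NormedSpace.expSeries_div_hasSum_exp (𝔸 := ℝ) (t * a)).mul_left (Real.exp (-t))
  rw [← Real.exp_eq_exp_ℝ, ← Real.exp_add] at h
  have e : t * (a - 1) = -t + t * a := by ring
  rw [e]
  refine Eq.mp (congrArg (HasSum · _) (funext fun k => ?_)) h
  rw [mul_pow]
  ring

theorem abs_degree_mul_transition_pow_le (hG : ∀ v, 0 < G.degree v) (k : ℕ) (i : Fin n) :
    |(G.degree i : ℝ) * (transition G ^ k) x₀ i| ≤ prefNorm G x₀ := by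
  rw [← sum_degree_mul_walk hG]
  refine (Finset.abs_sum_le_sum_abs _ _).trans (Finset.sum_le_sum fun v _ => ?_)
  rw [abs_mul, abs_mul, Nat.abs_cast, abs_of_nonneg ENNReal.toReal_nonneg]
  refine mul_le_of_le_one_right (by positivity) ?_
  exact ENNReal.toReal_le_of_le_ofReal zero_le_one (by simpa using PMF.coe_le_one _ _)

/-- The sign of `r`, with value `1` at `0`. -/
noncomputable def sgn (r : ℝ) : ℝ := if r < 0 then -1 else 1

theorem sgn_mul_abs (r : ℝ) : sgn r * |r| = r := by
  unfold sgn
  split_ifs with h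
  · rw [abs_of_neg h]; ring
  · rw [abs_of_nonneg (not_lt.1 h), one_mul]

theorem sgn_sq (r : ℝ) : sgn r ^ 2 = 1 := by
  unfold sgn
  split_ifs <;> norm_num

/-- The truncated and normalized estimator is biased by at most twice the Poisson tail. -/
theorem IsTrajectory.abs_mean_sub_le (hx : IsTrajectory G x) (hG : ∀ v, 0 < G.degree v)
    {t K a ε : ℝ} (ht : 0 ≤ t) (ha : 1 ≤ a)
    (hε : Real.exp (t * (a - 1)) * Real.exp (-(K * Real.log a)) ≤ ε)
    {ξ : PMF (Fin n)}
    (hξ : ∀ v, prefNorm G (x 0) * (ξ v).toReal = (G.degree v : ℝ) * |x 0 v|) (i : Fin n) :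
    |prefNorm G (x 0) * ∑ v, (ξ v).toReal * sgn (x 0 v) * (endLaw G t K v i).toReal -
      (G.degree i : ℝ) * x t i| ≤ 2 * ε * prefNorm G (x 0) := by
  set F := prefNorm G (x 0) with hF
  have hF0 : 0 ≤ F := prefNorm_nonneg G (x 0)
  have h1 : F * ∑ v, (ξ v).toReal * sgn (x 0 v) * (endLaw G t K v i).toReal =
      ∑ v, (G.degree v : ℝ) * x 0 v * (endLaw G t K v i).toReal := by
    rw [Finset.mul_sum]
    refine Finset.sum_congr rfl fun v _ => ?_
    calc F * ((ξ v).toReal * sgn (x 0 v) * (endLaw G t K v i).toReal)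
        = F * (ξ v).toReal * sgn (x 0 v) * (endLaw G t K v i).toReal := by ring
      _ = (G.degree v : ℝ) * (sgn (x 0 v) * |x 0 v|) * (endLaw G t K v i).toReal := by
        rw [hξ]; ring
      _ = _ := by rw [sgn_mul_abs]
  have h2 := hasSum_sum (s := Finset.univ) fun (v : Fin n) _ =>
    (hasSum_endLaw (G := G) ht K v i).mul_left ((G.degree v : ℝ) * x 0 v)
  have h3 := (hx.hasSum hG ht i).mul_left (G.degree i : ℝ)
  have h4 := h2.sub h3
  rw [h1]
  have h5 := ((hasSum_poisson_mul_pow t a).mul_right (Real.exp (-(K * Real.log a)))).mul_left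
    (2 * F)
  refine (h4.norm_le_of_bounded h5 fun k => ?_).trans
    ((mul_le_mul_of_nonneg_left hε (by positivity)).trans_eq (by ring))
  have h6 : ∑ v, (G.degree v : ℝ) * x 0 v * (Real.exp (-t) * t ^ k / k.factorial *
      (walk G (truncate K k) v i).toReal) = Real.exp (-t) * t ^ k / k.factorial *
      ((G.degree i : ℝ) * (transition G ^ truncate K k) (x 0) i) := by
    rw [← sum_degree_mul_walk hG, Finset.mul_sum]
    exact Finset.sum_congr rfl fun v _ => by ring
  rw [h6, mul_left_comm (G.degree i : ℝ), ← mul_sub, Real.norm_eq_abs, abs_mul,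
    abs_of_nonneg (by positivity : (0:ℝ) ≤ Real.exp (-t) * t ^ k / k.factorial)]
  have hp : (0:ℝ) ≤ Real.exp (-t) * t ^ k / k.factorial := by positivity
  -- Only lengths `k > K` contribute, each at most `2F`, and their indicator is at most `a^(k-K)`.
  have hr : |(G.degree i : ℝ) * (transition G ^ truncate K k) (x 0) i -
      (G.degree i : ℝ) * (transition G ^ k) (x 0) i| ≤
      2 * F * (a ^ k * Real.exp (-(K * Real.log a))) := by
    by_cases hk : K < k
    · have hak : 1 ≤ a ^ k * Real.exp (-(K * Real.log a)) := by
        rw [← Real.exp_log (by positivity : 0 < a ^ k), ← Real.exp_add, Real.log_pow]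
        refine Real.one_le_exp ?_
        have := mul_le_mul_of_nonneg_right hk.le (Real.log_nonneg ha)
        linarith
      have := abs_sub ((G.degree i : ℝ) * (transition G ^ truncate K k) (x 0) i)
        ((G.degree i : ℝ) * (transition G ^ k) (x 0) i)
      have b1 := abs_degree_mul_transition_pow_le (x 0) hG (truncate K k) i
      have b2 := abs_degree_mul_transition_pow_le (x 0) hG k i
      have := le_mul_of_one_le_right (by positivity : 0 ≤ 2 * F) hak
      linarith
    · rw [truncate, if_neg hk, sub_self, abs_zero]
      positivity
  refine (mul_le_mul_of_nonneg_left hr hp).trans_eq ?_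
  ring

end Sampling

/-! ### The supermartingale behind Chebyshev's inequality. -/

section SecondMoment

variable {ι : Type*} [Fintype ι]

/-- Bound for the normalized second moment after `m` further samples, from partial sums `s`. -/
noncomputable def potential (μ c : ι → ℝ) (w δ : ℝ) (m : ℕ) (s : ι → ℝ) : ℝ :=
  (∑ j, (s j + m * μ j - c j) ^ 2 + m * w ^ 2) / δ ^ 2

theorem potential_nonneg (μ c : ι → ℝ) (w δ : ℝ) (m : ℕ) (s : ι → ℝ) :
    0 ≤ potential μ c w δ m s :=
  div_nonneg (add_nonneg (Finset.sum_nonneg fun _ _ => sq_nonneg _) (by positivity))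
    (sq_nonneg _)

/-- The Markov step: a final error of at least `δ` in some coordinate forces potential at least `1`,
so the expected potential bounds the failure probability. -/
theorem one_le_potential_zero {μ c : ι → ℝ} {w δ : ℝ} (hδ : 0 < δ) {s : ι → ℝ} {i : ι}
    (h : δ ≤ |s i - c i|) : 1 ≤ potential μ c w δ 0 s := by
  rw [potential, le_div_iff₀ (by positivity), one_mul]
  have h1 : δ ^ 2 ≤ (s i - c i) ^ 2 := by
    rw [← sq_abs (s i - c i)]
    exact pow_le_pow_left₀ hδ.le h 2
  have h2 := Finset.single_le_sum (f := fun j => (s j - c j) ^ 2) (fun j _ => sq_nonneg _)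
    (Finset.mem_univ i)
  simp only [Nat.cast_zero, zero_mul, add_zero]
  exact h1.trans h2

theorem sum_toReal_eq_one (p : PMF ι) : ∑ i, (p i).toReal = 1 := by
  have h := p.tsum_coe
  rw [tsum_fintype] at h
  rw [← ENNReal.toReal_sum fun i _ => p.apply_ne_top i, h, ENNReal.toReal_one]

/-- With `a = s + mμ - c` and `X` the new sample, `E‖a + X‖² = ‖a‖² + 2⟨a, μ⟩ + w² ≤ ‖a + μ‖² + w²`.
As `X` has one nonzero entry `±w`, the variance term is free of the dimension. -/
theorem tsum_mul_potential_le [DecidableEq ι] {ξ : PMF ι} {q : ι → PMF ι} {u μ c : ι → ℝ} {w δ : ℝ}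
    (hu : ∀ v, u v ^ 2 = w ^ 2)
    (hμ : ∀ i, μ i = ∑ v, (ξ v).toReal * u v * (q v i).toReal) (m : ℕ) (s : ι → ℝ) :
    ∑' v, ξ v * ∑' i, q v i *
        ENNReal.ofReal (potential μ c w δ m (s + Pi.single i (u v))) ≤
      ENNReal.ofReal (potential μ c w δ (m + 1) s) := by
  have h1 : ∑' v, ξ v * ∑' i, q v i *
        ENNReal.ofReal (potential μ c w δ m (s + Pi.single i (u v))) =
      ENNReal.ofReal (∑ v, (ξ v).toReal * ∑ i, (q v i).toReal *
        potential μ c w δ m (s + Pi.single i (u v))) := by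
    have hq : ∀ v i, 0 ≤ (q v i).toReal * potential μ c w δ m (s + Pi.single i (u v)) :=
      fun v i => mul_nonneg ENNReal.toReal_nonneg (potential_nonneg ..)
    rw [ENNReal.ofReal_sum_of_nonneg fun v _ =>
      mul_nonneg ENNReal.toReal_nonneg (Finset.sum_nonneg fun i _ => hq v i), tsum_fintype]
    refine Finset.sum_congr rfl fun v _ => ?_
    rw [ENNReal.ofReal_mul ENNReal.toReal_nonneg, ENNReal.ofReal_toReal (ξ.apply_ne_top v),
      ENNReal.ofReal_sum_of_nonneg fun i _ => hq v i, tsum_fintype]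
    congr 1
    refine Finset.sum_congr rfl fun i _ => ?_
    rw [ENNReal.ofReal_mul ENNReal.toReal_nonneg, ENNReal.ofReal_toReal ((q v).apply_ne_top i)]
  rw [h1]
  refine ENNReal.ofReal_le_ofReal ?_
  set a : ι → ℝ := fun j => s j + m * μ j - c j with ha
  have h2 : ∀ v i, potential μ c w δ m (s + Pi.single i (u v)) =
      (∑ j, a j ^ 2 + 2 * (a i * u v) + w ^ 2 + m * w ^ 2) / δ ^ 2 := by
    intro v i
    rw [potential]
    congr 2
    have : ∀ j, ((s + Pi.single i (u v) : ι → ℝ) j + m * μ j - c j) ^ 2 =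
        a j ^ 2 + if j = i then 2 * (a i * u v) + w ^ 2 else 0 := by
      intro j
      by_cases hj : j = i
      · subst hj
        simp only [Pi.add_apply, Pi.single_eq_same, if_true, ha, ← hu v]
        ring
      · simp only [Pi.add_apply, Pi.single_eq_of_ne hj, if_neg hj, ha]
        ring
    simp_rw [this, Finset.sum_add_distrib]
    simp
    ring
  have h3 : ∑ v, (ξ v).toReal * ∑ i, (q v i).toReal *
        potential μ c w δ m (s + Pi.single i (u v)) =
      (∑ j, a j ^ 2 + 2 * ∑ i, a i * μ i + (m + 1) * w ^ 2) / δ ^ 2 := by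
    simp_rw [h2]
    set A := ∑ j, a j ^ 2 + (m + 1) * w ^ 2 with hA
    have e : ∀ v, (ξ v).toReal * ∑ i, (q v i).toReal *
        ((∑ j, a j ^ 2 + 2 * (a i * u v) + w ^ 2 + m * w ^ 2) / δ ^ 2) =
        (ξ v).toReal * (A / δ ^ 2) +
          2 / δ ^ 2 * ∑ i, a i * ((ξ v).toReal * u v * (q v i).toReal) := by
      intro v
      have : ∀ i, (q v i).toReal *
          ((∑ j, a j ^ 2 + 2 * (a i * u v) + w ^ 2 + m * w ^ 2) / δ ^ 2) =
          (q v i).toReal * (A / δ ^ 2) + 2 / δ ^ 2 * (a i * (u v * (q v i).toReal)) := by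
        intro i
        rw [hA]
        ring
      simp_rw [this, Finset.sum_add_distrib, ← Finset.sum_mul, sum_toReal_eq_one, mul_add,
        Finset.mul_sum]
      congr 1
      · ring
      · exact Finset.sum_congr rfl fun i _ => by ring
    simp_rw [e, Finset.sum_add_distrib, ← Finset.sum_mul, sum_toReal_eq_one, ← Finset.mul_sum]
    rw [Finset.sum_comm]
    simp_rw [← Finset.mul_sum, ← hμ]
    rw [hA]
    ring
  rw [h3, potential]
  refine div_le_div_of_nonneg_right ?_ (sq_nonneg _)
  -- Completing the square leaves the surplus `∑ μ_i²`, which is dropped.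
  have h4 : ∑ j, (s j + ((m + 1 : ℕ) : ℝ) * μ j - c j) ^ 2 =
      ∑ j, a j ^ 2 + 2 * ∑ i, a i * μ i + ∑ i, μ i ^ 2 := by
    rw [Finset.mul_sum, ← Finset.sum_add_distrib, ← Finset.sum_add_distrib]
    refine Finset.sum_congr rfl fun j _ => ?_
    rw [ha]
    push_cast
    ring
  rw [h4]
  push_cast
  have : 0 ≤ ∑ i, μ i ^ 2 := Finset.sum_nonneg fun _ _ => sq_nonneg _
  linarith

end SecondMoment


/-! ### The program and its analysis. -/

section Program

/-- Computes the cap `K = (1 + t) ℓ / log ℓ` with `ℓ = max (log (1/ε)) 3`, the weight `ε³ ‖x₀ᵀ D‖₁`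
and the bound `1/ε³` on the sample counter, then runs `p`. -/
def setup (p : Prog) : Prog :=
  .seq (.op (.natConst 4 1)) <| .seq (.op (.realConst 8 1)) <| .seq (.op (.realDiv 3 8 0)) <|
  .seq (.op (.realLog 3 3)) <| .seq (.op (.realConst 4 3)) <|
  -- The second alternative is a dummy: real register `4` is overwritten by the next instruction.
  .seq (.branch (.realLt 3 4) (.op (.realConst 3 3)) (.op (.realConst 4 0))) <|
  .seq (.op (.realLog 4 3)) <| .seq (.op (.realDiv 3 3 4)) <| .seq (.op (.realAdd 5 8 1)) <|
  .seq (.op (.realMul 4 5 3)) <| .seq (.op (.realMul 5 0 0)) <| .seq (.op (.realMul 5 5 0)) <|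
  .seq (.op (.realMul 6 5 2)) <| .seq (.op (.realDiv 5 8 5)) p

/-- Draws a start vertex, its signed weight and a truncated Poisson walk length, then runs `p`. -/
def draw (p : Prog) : Prog :=
  .seq (.op (.sampleStart 1)) <| .seq (.op (.initState 9 1)) <|
  -- Real register `12` is never written and serves as the constant `0`.
  .seq (.branch (.realLt 9 12) (.op (.realSub 9 12 6)) (.op (.realAdd 9 12 6))) <|
  .seq (.op (.samplePoisson 2 1)) <| .seq (.op (.natToReal 10 2)) <|
  -- The second alternative is again a dummy; natural register `5` is scratch space for `record`.
  .seq (.branch (.realLt 4 10) (.op (.natConst 2 0)) (.op (.natConst 5 0))) <|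
  .seq (.op (.natConst 3 0)) p

/-- Moves the current vertex along the random walk. -/
def walkLoop : Prog :=
  .loop (.natLt 3 2) (.seq (.op (.sampleNeighbor 1 1)) (.op (.natAdd 3 3 4)))

/-- Adds the signed weight divided by the degree to the memory cell of the current vertex. -/
def record : Prog :=
  .seq (.op (.degree 5 1)) <| .seq (.op (.natToReal 10 5)) <| .seq (.op (.realDiv 10 9 10)) <|
  .seq (.op (.load 11 1)) <| .seq (.op (.realAdd 11 11 10)) <| .seq (.op (.store 1 11)) <|
  .op (.realAdd 7 7 8)

/-- The main loop: one random walk per iteration. -/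
def sampleLoop : Prog := .loop (.realLt 7 5) (draw (.seq walkLoop record))

variable {n : ℕ} {G : SimpleGraph (Fin n)} [DecidableRel G.Adj] {x₀ : Fin n → ℝ}
  {E : Store → Prop} {t K w R : ℝ} {σ : Store} {k : List Prog} {j : ℕ} {s : Fin n → ℝ}
  {N : ℕ} {b : ℝ≥0∞}

/-- The constants are in place, `j` samples have been counted, and memory holds the sums `s`, scaled
by `‖x₀ᵀ D‖₁ / d_i`. -/
structure Ready (G : SimpleGraph (Fin n)) [DecidableRel G.Adj] (x₀ : Fin n → ℝ) (t K w R : ℝ)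
    (j : ℕ) (s : Fin n → ℝ) (σ : Store) : Prop where
  natOne : σ.nat 4 = 1
  mean : σ.real 1 = t
  cap : σ.real 4 = K
  bound : σ.real 5 = R
  weight : σ.real 6 = w * prefNorm G x₀
  count : σ.real 7 = j
  realOne : σ.real 8 = 1
  realZero : σ.real 12 = 0
  mem : ∀ i : Fin n, σ.mem i = prefNorm G x₀ / (G.degree i : ℝ) * s i

theorem Fails.seq_op {o : Op} {q : Prog} {σ' : Store} (hs : o.exec G x₀ σ = PMF.pure σ')
    (h : Fails G x₀ E ⟨q :: k, σ'⟩ N b) :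
    Fails G x₀ E ⟨.seq (.op o) q :: k, σ⟩ (N + 2) b :=
  (Fails.op hs h).seq

theorem Fails.seq_branch {c : Test} {o o' : Op} {q : Prog} {σ₁ σ₂ : Store}
    (hs : o.exec G x₀ σ = PMF.pure σ₁) (hs' : o'.exec G x₀ σ = PMF.pure σ₂)
    (h₁ : c.Holds σ → Fails G x₀ E ⟨q :: k, σ₁⟩ N b)
    (h₂ : ¬ c.Holds σ → Fails G x₀ E ⟨q :: k, σ₂⟩ N b) :
    Fails G x₀ E ⟨.seq (.branch c (.op o) (.op o')) q :: k, σ⟩ (N + 3) b := by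
  by_cases hc : c.Holds σ
  · exact (Fails.branch_true hc (Fails.op hs (h₁ hc))).seq
  · exact (Fails.branch_false hc (Fails.op hs' (h₂ hc))).seq

theorem fails_record {i : Fin n} {u : ℝ} (hσ : Ready G x₀ t K w R j s σ)
    (hi : σ.nat 1 = i) (hu : σ.real 9 = u * prefNorm G x₀)
    (h : ∀ σ', Ready G x₀ t K w R (j + 1) (s + Pi.single i u) σ' →
      Fails G x₀ E ⟨k, σ'⟩ N b) :
    Fails G x₀ E ⟨record :: k, σ⟩ (N + 13) b := by
  refine Fails.seq_op rfl <| Fails.seq_op rfl <| Fails.seq_op rfl <| Fails.seq_op rfl <|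
    Fails.seq_op rfl <| Fails.seq_op rfl <| Fails.op rfl <| h _ ?_
  obtain ⟨h1, h2, h3, h4, h5, h6, h7, h8, h9⟩ := hσ
  refine ⟨?_, ?_, ?_, ?_, ?_, ?_, ?_, ?_, fun l => ?_⟩ <;>
    simp [Store.setNat, Store.setReal, Store.setMem, *]
  by_cases hl : l = i
  · subst hl
    simp [degreeQuery]
    ring
  · have hl' : (l : ℕ) ≠ i := fun h => hl (Fin.ext h)
    simp [hl, hl', h9]

theorem Fails.random_map_val {o : Op} {q : Prog} {ξ : PMF (Fin n)} {f : ℕ → Store}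
    {β : Fin n → ℝ≥0∞} (hs : o.exec G x₀ σ = (ξ.map Fin.val).map f)
    (h : ∀ a : Fin n, Fails G x₀ E ⟨q :: k, f a⟩ N (β a)) :
    Fails G x₀ E ⟨.seq (.op o) q :: k, σ⟩ (N + 2) (∑' a, ξ a * β a) :=
  (Fails.random (hs.trans (PMF.map_comp _ _ _)) h).seq

/-- Induction on the remaining steps, with the start vertex free because `walk` peels off its first
step. A step costs four units: test, sequencing, draw, increment. -/
theorem fails_walkLoop {β : Fin n → ℝ≥0∞} {ρ : ℝ} {m : ℕ} {v : Fin n}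
    (hσ : Ready G x₀ t K w R j s σ) (hv : σ.nat 1 = v) (hm : σ.nat 2 = σ.nat 3 + m)
    (hρ : σ.real 9 = ρ)
    (h : ∀ (i : Fin n) (σ' : Store), Ready G x₀ t K w R j s σ' → σ'.nat 1 = i → σ'.real 9 = ρ →
      Fails G x₀ E ⟨k, σ'⟩ N (β i)) :
    Fails G x₀ E ⟨walkLoop :: k, σ⟩ (N + 1 + 4 * m) (∑' i, walk G m v i * β i) := by
  induction m generalizing v σ with
  | zero =>
    refine Fails.loop_false (by simp [Test.Holds, hm]) ?_
    have : ∑' i, walk G 0 v i * β i = β v := by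
      rw [tsum_eq_single v]
      · simp [walk]
      · intro i hi
        simp [walk, hi]
    rw [this]
    exact h v σ hσ hv hρ
  | succ m ih =>
    rw [walk, tsum_bind_mul]
    refine Fails.loop_true (N := N + 1 + 4 * m + 3) (by simp [Test.Holds, hm]) ?_
    refine Fails.random_map_val (N := N + 1 + 4 * m + 1)
      (f := σ.setNat 1) (by rw [Op.exec, hv, neighborPMF_eq_map]) fun a => ?_
    refine Fails.op rfl (ih ?_ ?_ ?_ ?_)
    · obtain ⟨h1, h2, h3, h4, h5, h6, h7, h8, h9⟩ := hσ
      constructor <;> simp [Store.setNat, *]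
    · simp [Store.setNat]
    · simp [Store.setNat, hm, hσ.natOne]
      ring
    · simpa [Store.setNat] using hρ

theorem exec_samplePoisson {a c : ℕ} (h : σ.real c = t) :
    (Op.samplePoisson a c).exec G x₀ σ =
      (ProbabilityTheory.poissonMeasure t.toNNReal).toPMF.map (σ.setNat a) := by
  subst h
  rfl

theorem fails_draw {ξ : PMF (Fin n)} {β : Fin n → ℕ → ℝ≥0∞} {q : Prog}
    (hξ : startPMF G x₀ = ξ.map Fin.val) (hσ : Ready G x₀ t K w R j s σ)
    (h : ∀ (v : Fin n) (l : ℕ) (σ' : Store), Ready G x₀ t K w R j s σ' → σ'.nat 1 = v →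
      σ'.nat 2 = truncate K l → σ'.nat 3 = 0 →
      σ'.real 9 = sgn (x₀ v) * w * prefNorm G x₀ → Fails G x₀ E ⟨q :: k, σ'⟩ N (β v l)) :
    Fails G x₀ E ⟨draw q :: k, σ⟩ (N + 16)
      (∑' v, ξ v * ∑' l, (ProbabilityTheory.poissonMeasure t.toNNReal).toPMF l * β v l) := by
  obtain ⟨h1, h2, h3, h4, h5, h6, h7, h8, h9⟩ := hσ
  refine Fails.random_map_val (f := σ.setNat 1) (by rw [Op.exec, hξ]) fun v => ?_
  have hx : stateQuery x₀ v = x₀ v := by simp [stateQuery]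
  refine Fails.seq_op (σ' := (σ.setNat 1 v).setReal 9 (x₀ v))
    (by simp [Op.exec, Store.setNat, hx]) ?_
  -- Both sign branches reach the same store, so the remaining instructions are analysed once.
  have key : ∀ τ : Store, τ = ((σ.setNat 1 v).setReal 9 (x₀ v)).setReal 9
      (sgn (x₀ v) * w * prefNorm G x₀) →
      Fails G x₀ E ⟨.seq (.op (.samplePoisson 2 1)) (.seq (.op (.natToReal 10 2)) <|
        .seq (.branch (.realLt 4 10) (.op (.natConst 2 0)) (.op (.natConst 5 0))) <|
        .seq (.op (.natConst 3 0)) q) :: k, τ⟩ (N + 9)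
      (∑' l, (ProbabilityTheory.poissonMeasure t.toNNReal).toPMF l * β v l) := by
    rintro τ rfl
    refine (Fails.random (exec_samplePoisson (by simp [Store.setReal, Store.setNat, h2]))
      fun l => ?_).seq
    refine Fails.seq_op rfl ?_
    refine Fails.seq_branch rfl rfl (fun hc => ?_) fun hc => ?_
    all_goals
      have hc' := hc
      simp [Test.Holds, Store.setReal, Store.setNat, h3] at hc'
      refine Fails.seq_op rfl (h v l _ ?_ ?_ ?_ ?_ ?_)
      · constructor <;> simp [Store.setNat, Store.setReal, *]
      · simp [Store.setNat, Store.setReal]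
      · simp [Store.setNat, Store.setReal, truncate, hc']
      · simp [Store.setNat, Store.setReal]
      · simp [Store.setNat, Store.setReal]
  refine Fails.seq_branch rfl rfl (fun hc => key _ ?_) fun hc => key _ ?_
  all_goals
    have hc' := hc
    simp [Test.Holds, Store.setReal, Store.setNat, h8] at hc'
  · simp [Store.setReal, Store.setNat, h8, h5, sgn, hc']
  · simp [Store.setReal, Store.setNat, h8, h5, sgn, not_lt.2 hc']

/-- With `m` walks left, the current potential bounds the failure probability. An iteration costs at
most `1 + 16 + 1 + (1 + 4⌊K⌋) + 13` units: test, draw, sequencing, walk, record. -/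
theorem fails_sampleLoop {ξ : PMF (Fin n)} {c μ : Fin n → ℝ} {δ : ℝ} {m : ℕ}
    (hξ : startPMF G x₀ = ξ.map Fin.val)
    (hμ : ∀ i, μ i = ∑ v, (ξ v).toReal * (sgn (x₀ v) * w) * (endLaw G t K v i).toReal)
    (hE : ∀ (s : Fin n → ℝ) (σ : Store), (∀ i : Fin n, σ.mem i =
      prefNorm G x₀ / (G.degree i : ℝ) * s i) → ¬ E σ → 1 ≤ potential μ c w δ 0 s)
    (hm : j + m = ⌈R⌉₊) (hσ : Ready G x₀ t K w R j s σ) :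
    Fails G x₀ E ⟨[sampleLoop], σ⟩ (1 + (32 + 4 * ⌊K⌋₊) * m)
      (ENNReal.ofReal (potential μ c w δ m s)) := by
  induction m generalizing j s σ with
  | zero =>
    refine Fails.loop_false ?_ (Fails.nil fun hEσ => ?_)
    -- An integer count is below `R` exactly when it is below `⌈R⌉`, so `⌈R⌉` walks are made.
    · rw [Test.Holds, hσ.count, hσ.bound, not_lt, ← Nat.ceil_le, ← hm, add_zero]
    · rw [← ENNReal.ofReal_one]
      exact ENNReal.ofReal_le_ofReal (hE s σ hσ.mem hEσ)
  | succ m ih =>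
    have hu : ∀ v, (sgn (x₀ v) * w) ^ 2 = w ^ 2 := fun v => by rw [mul_pow, sgn_sq, one_mul]
    refine Fails.mono (N := 1 + (32 + 4 * ⌊K⌋₊) * m + 13 + 1 + 4 * ⌊K⌋₊ + 1 + 16 + 1) ?_
      (by ring_nf; omega)
      (tsum_mul_potential_le hu hμ m s)
    refine Fails.loop_true ?_ ?_
    · rw [Test.Holds, hσ.count, hσ.bound, ← Nat.lt_ceil, ← hm]
      omega
    · simp_rw [endLaw, tsum_bind_mul]
      refine fails_draw hξ hσ fun v l σ' hσ' hv h2 h3 h9 => ?_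
      have hl := truncate_le K l
      refine Fails.seq (Fails.mono
        (fails_walkLoop (N := 1 + (32 + 4 * ⌊K⌋₊) * m + 13) (m := truncate K l) hσ' hv
          (by rw [h2, h3, zero_add]) h9
        fun i τ hτ hi hρ => fails_record hτ hi hρ fun τ' hτ' => ih (by omega) hτ') ?_ le_rfl)
      omega

theorem fails_setup {ε : ℝ} {q : Prog}
    (h : ∀ σ, Ready G x₀ t ((1 + t) * (max (Real.log (1 / ε)) 3 /
      Real.log (max (Real.log (1 / ε)) 3))) (ε ^ 3) (1 / ε ^ 3) 0 0 σ →
      Fails G x₀ E ⟨[q], σ⟩ N b) :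
    Fails G x₀ E (initConfig G x₀ t ε (setup q)) (N + 29) b := by
  refine Fails.seq_op rfl <| Fails.seq_op rfl <| Fails.seq_op rfl <| Fails.seq_op rfl <|
    Fails.seq_op rfl <| Fails.seq_branch rfl rfl (fun hc => ?_) fun hc => ?_
  all_goals
    simp [Test.Holds, Store.setReal, Store.setNat] at hc
    refine Fails.seq_op rfl <| Fails.seq_op rfl <| Fails.seq_op rfl <| Fails.seq_op rfl <|
      Fails.seq_op rfl <| Fails.seq_op rfl <| Fails.seq_op rfl <| Fails.seq_op rfl <| h _ ?_
  · have hmax : max (Real.log (1 / ε)) 3 = 3 := max_eq_right (by simpa using hc.le)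
    rw [hmax]
    constructor <;> simp [Store.setReal, Store.setNat, pow_succ]
  · have hmax : max (Real.log (1 / ε)) 3 = Real.log (1 / ε) := max_eq_left (by simpa using hc)
    rw [hmax]
    constructor <;> simp [Store.setReal, Store.setNat, pow_succ]

end Program


/-! ### Numerical estimates for the cap and the running time. -/

section Bounds

variable {ε t : ℝ}

/-- The cap is chosen so that `K log ℓ = (1+t)ℓ`; with `a = ℓ` the exponent is `t(ℓ-1) - (1+t)ℓ = -t
- ℓ ≤ log ε`. -/
theorem chernoff_le (h0 : 0 < ε) (ht : 0 ≤ t) :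
    Real.exp (t * (max (Real.log (1 / ε)) 3 - 1)) *
      Real.exp (-((1 + t) * (max (Real.log (1 / ε)) 3 / Real.log (max (Real.log (1 / ε)) 3)) *
        Real.log (max (Real.log (1 / ε)) 3))) ≤ ε := by
  set l := max (Real.log (1 / ε)) 3 with hl
  have hl3 : 3 ≤ l := le_max_right _ _
  have hl1 : Real.log (1 / ε) ≤ l := le_max_left _ _
  have hlog : 0 < Real.log l := Real.log_pos (by linarith)
  have e : (1 + t) * (l / Real.log l) * Real.log l = (1 + t) * l := by
    field_simp
  rw [e, ← Real.exp_add, ← Real.le_log_iff_exp_le h0]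
  rw [one_div, Real.log_inv] at hl1
  nlinarith

/-- Only rational constants can be loaded, so the program uses `3` where `logInv` uses `e`; since `e
≤ 3 ≤ 2e`, this costs at most a factor `2`. -/
theorem cap_le (ε : ℝ) : max (Real.log (1 / ε)) 3 / Real.log (max (Real.log (1 / ε)) 3) ≤
    2 * (logInv ε / Real.log (logInv ε)) := by
  have he := Real.exp_one_gt_d9
  have he' := Real.exp_one_lt_d9
  have hL : Real.exp 1 ≤ logInv ε := le_max_right _ _
  have hLl : logInv ε ≤ max (Real.log (1 / ε)) 3 := max_le_max le_rfl (by linarith)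
  have hlL : max (Real.log (1 / ε)) 3 ≤ 2 * logInv ε := by
    have : Real.log (1 / ε) ≤ logInv ε := le_max_left _ _
    exact max_le (by linarith) (by linarith)
  have hlog : 1 ≤ Real.log (logInv ε) := by
    rw [Real.le_log_iff_exp_le (by linarith)]
    exact hL
  have hlog' : Real.log (logInv ε) ≤ Real.log (max (Real.log (1 / ε)) 3) :=
    Real.log_le_log (by linarith) hLl
  rw [← mul_div_assoc]
  exact div_le_div₀ (by linarith) hlL (by linarith) hlog'

theorem one_le_logInv_div_log (ε : ℝ) : 1 ≤ logInv ε / Real.log (logInv ε) := by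
  have hL : Real.exp 1 ≤ logInv ε := le_max_right _ _
  have h0 : 0 < logInv ε := (Real.exp_pos 1).trans_le hL
  have hlog : 1 ≤ Real.log (logInv ε) := by
    rw [Real.le_log_iff_exp_le h0]
    exact hL
  rw [one_le_div (by linarith)]
  have := Real.log_le_sub_one_of_pos h0
  linarith

theorem one_le_inv_cube (h0 : 0 < ε) (h1 : ε < 1) : 1 ≤ 1 / ε ^ 3 := by
  rw [one_le_div (by positivity)]
  exact pow_le_one₀ h0.le h1.le

theorem ceil_le_two_mul (h0 : 0 < ε) (h1 : ε < 1) : (⌈1 / ε ^ 3⌉₊ : ℝ) ≤ 2 * (1 / ε ^ 3) := by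
  have h := (Nat.ceil_lt_add_one (by positivity : 0 ≤ 1 / ε ^ 3)).le
  have := one_le_inv_cube h0 h1
  linarith

theorem time_le {n : ℕ} (hn : 2 ≤ n) (h0 : 0 < ε) (h1 : ε < 1) (ht : 0 ≤ t) :
    ((1 + (32 + 4 * ⌊(1 + t) * (max (Real.log (1 / ε)) 3 /
      Real.log (max (Real.log (1 / ε)) 3))⌋₊) * ⌈1 / ε ^ 3⌉₊ + 29 : ℕ) : ℝ) ≤
      220 * (1 + t) * hkprComplexity n ε := by
  set K := (1 + t) * (max (Real.log (1 / ε)) 3 / Real.log (max (Real.log (1 / ε)) 3)) with hK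
  have hA := one_le_logInv_div_log ε
  have hcap := cap_le ε
  set A := logInv ε / Real.log (logInv ε) with hA'
  have hK0 : 0 ≤ K := by
    have : 3 ≤ max (Real.log (1 / ε)) 3 := le_max_right _ _
    have : 0 ≤ Real.log (max (Real.log (1 / ε)) 3) := Real.log_nonneg (by linarith)
    positivity
  have hf : (⌊K⌋₊ : ℝ) ≤ 2 * ((1 + t) * A) := by
    refine (Nat.floor_le hK0).trans ?_
    have := mul_le_mul_of_nonneg_left hcap (by linarith : 0 ≤ 1 + t)
    linarith
  have hr := ceil_le_two_mul h0 h1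
  have hR := one_le_inv_cube h0 h1
  set R := 1 / ε ^ 3 with hR'
  have hlogn : 1 / 2 ≤ Real.log n := by
    have h2 : Real.log 2 ≤ Real.log n := Real.log_le_log (by norm_num) (by exact_mod_cast hn)
    have := Real.log_two_gt_d9
    linarith
  have hc : hkprComplexity n ε = A * R * Real.log n := by
    rw [hkprComplexity, hA', hR', div_mul_div_comm, div_mul_eq_mul_div, mul_one, mul_comm (ε ^ 3)]
  have hB : 1 ≤ (1 + t) * A := by nlinarith
  set B := (1 + t) * A with hB'
  -- From `B ≥ 1`, `32 + 8B ≤ 40B`. The loop thus costs at most `80BR`, the other `30` steps at most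
  -- `30BR`, and `log n ≥ 1/2` turns `110` into `220`.
  have hmain : (32 + 4 * (⌊K⌋₊ : ℝ)) * (⌈R⌉₊ : ℝ) ≤ (40 * B) * (2 * R) :=
    mul_le_mul (by linarith) hr (Nat.cast_nonneg _) (by linarith)
  have hBR : 1 ≤ B * R := one_le_mul_of_one_le_of_one_le hB hR
  have hfin : 220 * (1 + t) * hkprComplexity n ε = 220 * (B * R) * Real.log n := by
    rw [hc, hB']
    ring
  rw [hfin]
  push_cast
  nlinarith

end Bounds

/-! ### Assembly of the error and time bounds. -/

variable {n : ℕ} {G : SimpleGraph (Fin n)} [DecidableRel G.Adj] {x : ℝ → Fin n → ℝ}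

/-- The loop, run on the output of the setup, approximates the state. -/
theorem fails_setup_sampleLoop (hx : IsTrajectory G x) (hn : 0 < n) (hG : ∀ v, 0 < G.degree v)
    {t ε : ℝ} (ht : 0 ≤ t) (h0 : 0 < ε) (h1 : ε < 1) :
    Fails G (x 0) (fun σ => Approximates G (x 0) ε 5 (x t) fun i => σ.mem i)
      (initConfig G (x 0) t ε (setup sampleLoop))
      (1 + (32 + 4 * ⌊(1 + t) * (max (Real.log (1 / ε)) 3 /
        Real.log (max (Real.log (1 / ε)) 3))⌋₊) * ⌈1 / ε ^ 3⌉₊ + 29) (ENNReal.ofReal ε) := by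
  obtain ⟨ξ, hξ, hξw⟩ := exists_startPMF_eq_map G (x 0) hn
  set K := (1 + t) * (max (Real.log (1 / ε)) 3 / Real.log (max (Real.log (1 / ε)) 3)) with hK
  set F := prefNorm G (x 0) with hF
  have hF0 : 0 ≤ F := prefNorm_nonneg G (x 0)
  have hl3 : 3 ≤ max (Real.log (1 / ε)) 3 := le_max_right _ _
  set mean : Fin n → ℝ := fun i => ∑ v, (ξ v).toReal * sgn (x 0 v) * (endLaw G t K v i).toReal
    with hmean
  have hbias : ∀ i, |F * mean i - (G.degree i : ℝ) * x t i| ≤ 2 * ε * F := fun i =>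
    hx.abs_mean_sub_le hG ht (by linarith) (chernoff_le h0 ht) hξw i
  have hmean1 : ∀ i, |mean i| ≤ 1 := by
    intro i
    rw [← sum_toReal_eq_one ξ]
    refine (Finset.abs_sum_le_sum_abs _ _).trans (Finset.sum_le_sum fun v _ => ?_)
    have hs : |sgn (x 0 v)| = 1 := by
      rw [← sq_eq_sq₀ (abs_nonneg _) zero_le_one, sq_abs, sgn_sq, one_pow]
    rw [abs_mul, abs_mul, hs, mul_one, abs_of_nonneg ENNReal.toReal_nonneg,
      abs_of_nonneg ENNReal.toReal_nonneg]
    refine mul_le_of_le_one_right ENNReal.toReal_nonneg ?_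
    exact ENNReal.toReal_le_of_le_ofReal zero_le_one (by simpa using PMF.coe_le_one _ _)
  set r := ⌈1 / ε ^ 3⌉₊ with hr
  have hr1 : 1 / ε ^ 3 ≤ r := Nat.le_ceil _
  have hr2 : (r : ℝ) < 1 / ε ^ 3 + 1 := Nat.ceil_lt_add_one (by positivity)
  have hr3 : (r : ℝ) ≤ 2 * (1 / ε ^ 3) := ceil_le_two_mul h0 h1
  have hε3 : 0 < ε ^ 3 := by positivity
  have hε3' : ε ^ 3 ≤ ε := by
    have : ε ^ 2 ≤ 1 := pow_le_one₀ h0.le h1.le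
    nlinarith
  -- Rounding the sample count up changes the total weight `rε³` by at most `ε³ ≤ ε`.
  have hrw : |r * ε ^ 3 - 1| ≤ ε := by
    rw [div_le_iff₀ hε3] at hr1
    have : (r : ℝ) * ε ^ 3 ≤ 1 + ε ^ 3 := by
      have := mul_le_mul_of_nonneg_right hr2.le hε3.le
      rwa [add_mul, one_div, inv_mul_cancel₀ hε3.ne', one_mul] at this
    rw [abs_of_nonneg (by linarith)]
    linarith
  refine fails_setup fun σ hσ => ?_
  -- Centring at the total mean makes the initial potential `r ε⁶ / (2ε)² ≤ 2ε³ / (4ε²) = ε/2`.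
  refine (fails_sampleLoop (c := fun i => r * (ε ^ 3 * mean i)) (μ := fun i => ε ^ 3 * mean i)
    (δ := 2 * ε) (m := r) hξ (fun i => ?_) (fun s τ hτ hE => ?_) (zero_add _) hσ).mono le_rfl
    (ENNReal.ofReal_le_ofReal ?_)
  · rw [hmean, Finset.mul_sum]
    exact Finset.sum_congr rfl fun v _ => by ring
  · rw [Approximates] at hE
    push Not at hE
    obtain ⟨i, hi⟩ := hE
    refine one_le_potential_zero (by positivity) (i := i) ?_
    by_contra! hlt
    refine absurd hi (not_lt.2 ?_)
    have hd : 0 < (G.degree i : ℝ) := by exact_mod_cast hG i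
    have hFd : 0 ≤ F / (G.degree i : ℝ) := by positivity
    set q := F / (G.degree i : ℝ) with hq
    -- The error splits into sampling (`2ε`), rounding of the sample count (`ε`) and bias (`2ε`), in
    -- units of `F/d_i`; hence the constant `5`.
    have e : τ.mem i - x t i = q * (s i - r * (ε ^ 3 * mean i)) +
        q * ((r * ε ^ 3 - 1) * mean i) + (F * mean i - (G.degree i : ℝ) * x t i) / G.degree i := by
      rw [hτ i, hq]
      field_simp
      ring
    have b1 : |q * (s i - r * (ε ^ 3 * mean i))| ≤ q * (2 * ε) := by
      rw [abs_mul, abs_of_nonneg hFd]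
      exact mul_le_mul_of_nonneg_left hlt.le hFd
    have b2 : |q * ((r * ε ^ 3 - 1) * mean i)| ≤ q * ε := by
      rw [abs_mul, abs_of_nonneg hFd, abs_mul]
      refine mul_le_mul_of_nonneg_left ?_ hFd
      exact (mul_le_mul hrw (hmean1 i) (abs_nonneg _) h0.le).trans_eq (mul_one _)
    have b3 : |(F * mean i - (G.degree i : ℝ) * x t i) / G.degree i| ≤ q * (2 * ε) := by
      rw [abs_div, Nat.abs_cast, div_le_iff₀ hd]
      refine (hbias i).trans_eq ?_
      rw [hq]
      field_simp
    rw [e]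
    have b4 := abs_add_three (q * (s i - r * (ε ^ 3 * mean i))) (q * ((r * ε ^ 3 - 1) * mean i))
      ((F * mean i - (G.degree i : ℝ) * x t i) / G.degree i)
    have b5 : 0 ≤ ε * |x t i| := by positivity
    linarith
  · rw [potential, div_le_iff₀ (by positivity)]
    simp only [Pi.zero_apply, zero_add, sub_self, ne_eq, OfNat.ofNat_ne_zero, not_false_eq_true,
      zero_pow, Finset.sum_const_zero]
    have h2 : (r : ℝ) * (ε ^ 3) ^ 2 ≤ 2 * (1 / ε ^ 3) * (ε ^ 3) ^ 2 :=
      mul_le_mul_of_nonneg_right hr3 (by positivity)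
    have h3 : 2 * (1 / ε ^ 3) * (ε ^ 3) ^ 2 = 2 * ε ^ 3 := by
      field_simp
    nlinarith

end WeightedConsensus

theorem theorem3 :
    ∃ (p : WeightedConsensus.Prog) (C B : ℝ),
      ∀ (n : ℕ), 2 ≤ n →
      ∀ (G : SimpleGraph (Fin n)) [DecidableRel G.Adj], G.Connected →
      ∀ (x : ℝ → Fin n → ℝ), WeightedConsensus.IsTrajectory G x →
      ∀ (t : ℝ), 0 ≤ t → ∀ (ε : ℝ), 0 < ε → ε < 1 →
      ∃ T : ℕ,
        (T : ℝ) ≤ B * (1 + t) * WeightedConsensus.hkprComplexity n ε ∧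
        (∀ c ∈ (WeightedConsensus.run G (x 0) T
            (WeightedConsensus.initConfig G (x 0) t ε p)).support, c.Halted) ∧
        ENNReal.ofReal (1 - ε) ≤
          (WeightedConsensus.run G (x 0) T
            (WeightedConsensus.initConfig G (x 0) t ε p)).toOuterMeasure
            {c | WeightedConsensus.Approximates G (x 0) ε C (x t) c.output} := by
  refine ⟨WeightedConsensus.setup WeightedConsensus.sampleLoop, 5, 220,
    fun n hn G _ hG x hx t ht ε h0 h1 => ?_⟩
  have : Nontrivial (Fin n) := Fin.nontrivial_iff_two_le.2 hn
  have hdeg : ∀ v, 0 < G.degree v := fun v => hG.preconnected.degree_pos_of_nontrivial v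
  have h := WeightedConsensus.fails_setup_sampleLoop hx (by omega) hdeg ht h0 h1
  exact ⟨_, WeightedConsensus.time_le hn h0 h1 ht, (h _ le_rfl).1, h.success h0.le⟩
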